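/- Let $\mathsf{k}$ be a field of characteristic zero, let $X=\{x_1,\dots,x_m\}$ be a finite set, and let ${\rm Ass}_X$ be the free associative $\mathsf{k}$-algebra on $X$ (noncommutative polynomials in the $x_i$), with homogeneous components ${\rm Ass}_X^k$. Let $L_X\subset{\rm Ass}_X$ be the Lie subalgebra generated by $X$ for the bracket $[a,b]=ab-ba$, and $L_X^k=L_X\cap{\rm Ass}_X^k$. Let $*$ be the bilinear shuffle product on ${\rm Ass}_X$: for two words $u,v$ of lengths $r,s$, $u*v$ is the sum of the $\binom{r+s}{r}$ words, counted with multiplicity, obtained by interleaving $u$ and $v$ while keeping the letters of each of them in their original order. Let $$S_X^k={\rm Span}\{\,\omega_1*\omega_2 : \omega_1\in{\rm Ass}_X^{k_1},\ \omega_2\in{\rm Ass}_X^{k_2},\ k_1,k_2\ge 1,\ k_1+k_2=k\,\}.$$ Let $\langle\cdot,\cdot\rangle$ be the symmetric $\mathsf{k}$-bilinear form on ${\rm Ass}_X$ for which $\langle u,v\rangle=1$ if $u,v$ are equal words and $\langle u,v\rangle=0$ if they are different words. Then for every integer $k\ge 1$ the spaces $L_X^k$ and $S_X^k$ are orthogonal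 subspaces of ${\rm Ass}_X^k$ for $\langle\cdot,\cdot\rangle$, and $${\rm Ass}_X^k=L_X^k\oplus S_X^k .$$ -/

import Mathlib

/-! Lie elements and shuffle products in the free associative algebra `FreeAlgebra 𝕜 X`. -/

namespace FreeAss

noncomputable section

attribute [local instance] LieRing.ofAssociativeRing

variable (𝕜 : Type*) [Field 𝕜] {X : Type*}

/-- The noncommutative monomial `x_{i_1} x_{i_2} ⋯ x_{i_r}` of a word. -/
def word (w : FreeMonoid X) : FreeAlgebra 𝕜 X :=
  FreeMonoid.lift (FreeAlgebra.ι 𝕜) w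

/-- The basis of monomials, by which the bilinear maps below are defined, consists of the words. -/
theorem basisFreeMonoid_apply (w : FreeMonoid X) :
    FreeAlgebra.basisFreeMonoid 𝕜 X w = word 𝕜 w := by
  simp [FreeAlgebra.basisFreeMonoid, FreeAlgebra.equivMonoidAlgebraFreeMonoid, word]

variable (X) in
/-- The homogeneous component of degree `n` of the free associative algebra: the span of the
monomials of length `n`. -/
def ass (n : ℕ) : Submodule 𝕜 (FreeAlgebra 𝕜 X) :=
  Submodule.span 𝕜 {a | ∃ w : FreeMonoid X, w.length = n ∧ word 𝕜 w = a}

variable (X) in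
/-- The Lie algebra of Lie elements: the Lie subalgebra of the free associative algebra, with the
bracket `ab - ba`, generated by the letters. -/
def lieElements : LieSubalgebra 𝕜 (FreeAlgebra 𝕜 X) :=
  LieSubalgebra.lieSpan 𝕜 (FreeAlgebra 𝕜 X) (Set.range (FreeAlgebra.ι 𝕜))

variable (X) in
/-- The space of homogeneous Lie elements of degree `n`. -/
def lieComponent (n : ℕ) : Submodule 𝕜 (FreeAlgebra 𝕜 X) :=
  (lieElements 𝕜 X).toSubmodule ⊓ ass 𝕜 X n

/-- All interleavings of two words that keep the letters of either word in their order, listed with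
multiplicity: one for each choice of the positions of the letters of the first word. Each one starts
either with the first letter of the first word or with the first letter of the second word. -/
def shuffles : List X → List X → List (List X)
  | [], v => [v]
  | a :: u, [] => [a :: u]
  | a :: u, b :: v =>
      (shuffles u (b :: v)).map (List.cons a) ++ (shuffles (a :: u) v).map (List.cons b)
termination_by u v => u.length + v.length

/-- The shuffle product of two words, as the sum of all their shuffles. -/
def shuffleWords (u v : FreeMonoid X) : FreeAlgebra 𝕜 X :=
  ((shuffles u.toList v.toList).map fun w => word 𝕜 (FreeMonoid.ofList w)).sum

variable (X) in
/-- The shuffle product on the free associative algebra: the bilinear extension of the shuffle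
product of words. -/
def shuffle : FreeAlgebra 𝕜 X →ₗ[𝕜] FreeAlgebra 𝕜 X →ₗ[𝕜] FreeAlgebra 𝕜 X :=
  (FreeAlgebra.basisFreeMonoid 𝕜 X).constr 𝕜 fun u =>
    (FreeAlgebra.basisFreeMonoid 𝕜 X).constr 𝕜 fun v => shuffleWords 𝕜 u v

theorem shuffle_word (u v : FreeMonoid X) :
    shuffle 𝕜 X (word 𝕜 u) (word 𝕜 v) = shuffleWords 𝕜 u v := by
  simp only [shuffle, ← basisFreeMonoid_apply, Module.Basis.constr_basis]

variable (X) in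
/-- The span of the shuffle products of total degree `n` of two homogeneous elements of positive
degree. -/
def shuffleComponent (n : ℕ) : Submodule 𝕜 (FreeAlgebra 𝕜 X) :=
  Submodule.span 𝕜 {c | ∃ p q : ℕ, 0 < p ∧ 0 < q ∧ p + q = n ∧
    ∃ a ∈ ass 𝕜 X p, ∃ b ∈ ass 𝕜 X q, shuffle 𝕜 X a b = c}

open Classical in
variable (X) in
/-- The canonical bilinear form on the free associative algebra, for which the words are
orthonormal. -/
def wordForm : LinearMap.BilinForm 𝕜 (FreeAlgebra 𝕜 X) :=
  (FreeAlgebra.basisFreeMonoid 𝕜 X).toDual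

open Classical in
theorem wordForm_word (u v : FreeMonoid X) :
    wordForm 𝕜 X (word 𝕜 u) (word 𝕜 v) = if u = v then 1 else 0 := by
  simp only [wordForm, ← basisFreeMonoid_apply, Module.Basis.toDual_apply]

end

end FreeAss

/-!
The shuffle product is adjoint, for the word form, to the coproduct for which the letters are
primitive. Lie elements are primitive, hence orthogonal to every shuffle of two elements of positive
degree. Conversely, a homogeneous element of degree `n` orthogonal to these shuffles is primitive.
The convolution of the antipode with the Euler operator always takes values in Lie elements, and it
multiplies a primitive element of degree `n` by `n`, so such an element is a Lie element.

The form is not definite over a general field, but shuffles of words have integer coordinates, and a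
space spanned by vectors with rational coordinates in an orthonormal basis meets its orthogonal only
in `0`. If finite-dimensional, it is then complemented by its orthogonal. The components need not be
finite-dimensional when there are infinitely many letters, but one can split each word inside the
span of its rearrangements, which is orthogonal to the shuffles of all other words.
-/

section LinearAlgebra

variable {ι : Type*}

section CommSemiring

variable {R M : Type*} [CommSemiring R] [AddCommMonoid M] [Module R M]

theorem toDual_apply_eq_sum_support [DecidableEq ι] (b : Module.Basis ι R M) (y x : M) :
    b.toDual y x = ∑ i ∈ (b.repr x).support, b.repr x i * b.repr y i := by
  conv_lhs => rw [← b.linearCombination_repr x, Finsupp.linearCombination_apply, Finsupp.sum]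
  simp only [map_sum, map_smul, Module.Basis.toDual_apply_left, smul_eq_mul]

theorem isSymm_toDual [DecidableEq ι] (b : Module.Basis ι R M) :
    LinearMap.BilinForm.IsSymm b.toDual := by
  refine (LinearMap.BilinForm.isSymm_iff_basis b).2 fun i j => ?_
  simp only [Module.Basis.toDual_apply, eq_comm]

end CommSemiring

variable {𝕜 E : Type*} [Field 𝕜] [AddCommGroup E] [Module 𝕜 E]

theorem disjoint_span_orthogonal_of_repr_mem_range [CharZero 𝕜] [DecidableEq ι]
    (b : Module.Basis ι 𝕜 E) {s : Set E}
    (hs : ∀ v ∈ s, ∀ i, b.repr v i ∈ (algebraMap ℚ 𝕜).range) :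
    Disjoint (Submodule.span 𝕜 s)
      (LinearMap.BilinForm.orthogonal b.toDual (Submodule.span 𝕜 s)) := by
  rw [Submodule.disjoint_def]
  intro x hx horth
  -- An arbitrary field has no positivity: it is recovered by applying `ℚ`-linear functionals `φ`
  -- to the coordinates, for which the relation below, with `y = x`, is a vanishing sum of squares.
  have sum_eq_zero (φ : 𝕜 →ₗ[ℚ] ℚ) {y : E} (hy : y ∈ Submodule.span 𝕜 s) (c : 𝕜) :
      ∑ i ∈ (b.repr x).support, φ (b.repr x i) * φ (b.repr (c • y) i) = 0 := by
    induction hy using Submodule.span_induction generalizing c with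
    | mem v hv =>
      choose q hq using hs v hv
      have hvx : ∑ i ∈ (b.repr x).support, b.repr x i * b.repr v i = 0 :=
        (toDual_apply_eq_sum_support b v x).symm.trans (horth v (Submodule.subset_span hv))
      have φ_mul (i : ι) (d : 𝕜) : φ (d * b.repr v i) = φ d * q i := by
        rw [← hq, mul_comm, ← Algebra.smul_def, map_smul, smul_eq_mul, mul_comm]
      calc ∑ i ∈ (b.repr x).support, φ (b.repr x i) * φ (b.repr (c • v) i)
          = φ c * φ (∑ i ∈ (b.repr x).support, b.repr x i * b.repr v i) := by
            simp only [map_sum, Finset.mul_sum, map_smul, Finsupp.smul_apply, smul_eq_mul, φ_mul]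
            exact Finset.sum_congr rfl fun i _ => by ring
        _ = 0 := by rw [hvx, map_zero, mul_zero]
    | zero => simp
    | add y z _ _ hy hz =>
      simp only [smul_add, map_add, Finsupp.add_apply, mul_add, Finset.sum_add_distrib, hy, hz,
        add_zero]
    | smul d y _ hy => simpa only [smul_smul] using hy (c * d)
  refine b.ext_elem fun i => ?_
  rw [map_zero, Finsupp.zero_apply, ← Module.forall_dual_apply_eq_zero_iff ℚ]
  intro φ
  by_cases hi : i ∈ (b.repr x).support
  · have hsq := sum_eq_zero φ hx 1
    rw [one_smul, Finset.sum_eq_zero_iff_of_nonneg fun _ _ => mul_self_nonneg _] at hsq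
    exact mul_self_eq_zero.1 (hsq i hi)
  · rw [Finsupp.notMem_support_iff.1 hi, map_zero]

theorem isCompl_orthogonal_of_disjoint {B : LinearMap.BilinForm 𝕜 E} (hB : B.IsRefl)
    {W : Submodule 𝕜 E} [FiniteDimensional 𝕜 W] (hW : Disjoint W (B.orthogonal W)) :
    IsCompl W (B.orthogonal W) := by
  have hnondeg := B.nondegenerate_restrict_of_disjoint_orthogonal hB hW
  refine ⟨hW, codisjoint_iff.2 (eq_top_iff.2 fun x _ => ?_)⟩
  let y : W := (LinearMap.BilinForm.toDual _ hnondeg).symm ((B x).domRestrict W)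
  have hy (z : W) : B y z = B x z :=
    LinearMap.BilinForm.apply_toDual_symm_apply (hB := hnondeg) _ z
  rw [← add_sub_cancel (y : E) x]
  refine Submodule.add_mem_sup y.2 fun z hz => hB _ _ ?_
  rw [map_sub, LinearMap.sub_apply, hy ⟨z, hz⟩, sub_self]

end LinearAlgebra

namespace FreeAss

noncomputable section

attribute [local instance] LieRing.ofAssociativeRing

open scoped TensorProduct

variable (𝕜 : Type*) [Field 𝕜] {X : Type*}

/-- The monomial of a word given as a list of letters, which is the form convenient for inductions
on the first letter. -/
def mono (l : List X) : FreeAlgebra 𝕜 X := word 𝕜 (FreeMonoid.ofList l)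

theorem basisFreeMonoid_eq_mono (w : FreeMonoid X) :
    FreeAlgebra.basisFreeMonoid 𝕜 X w = mono 𝕜 w.toList :=
  basisFreeMonoid_apply 𝕜 w

theorem mono_nil : mono 𝕜 ([] : List X) = 1 := by
  simp only [mono, word, FreeMonoid.ofList_nil, map_one]

theorem mono_cons (x : X) (l : List X) : mono 𝕜 (x :: l) = FreeAlgebra.ι 𝕜 x * mono 𝕜 l := by
  simp only [mono, word, FreeMonoid.ofList_cons, map_mul, FreeMonoid.lift_eval_of]

theorem mono_append (l m : List X) : mono 𝕜 (l ++ m) = mono 𝕜 l * mono 𝕜 m := by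
  simp only [mono, word, FreeMonoid.ofList_append, map_mul]

variable {𝕜} in
theorem linearMap_ext_mono {M : Type*} [AddCommMonoid M] [Module 𝕜 M]
    {f g : FreeAlgebra 𝕜 X →ₗ[𝕜] M} (h : ∀ l, f (mono 𝕜 l) = g (mono 𝕜 l)) : f = g :=
  (FreeAlgebra.basisFreeMonoid 𝕜 X).ext fun w => by
    simpa only [basisFreeMonoid_eq_mono] using h w.toList

variable {𝕜} in
theorem linearMap_ext_mono₂ {M : Type*} [AddCommMonoid M] [Module 𝕜 M]
    {f g : FreeAlgebra 𝕜 X →ₗ[𝕜] FreeAlgebra 𝕜 X →ₗ[𝕜] M}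
    (h : ∀ l m, f (mono 𝕜 l) (mono 𝕜 m) = g (mono 𝕜 l) (mono 𝕜 m)) : f = g :=
  linearMap_ext_mono fun l => linearMap_ext_mono fun m => h l m

theorem wordForm_mono [DecidableEq X] (u v : List X) :
    wordForm 𝕜 X (mono 𝕜 u) (mono 𝕜 v) = if u = v then 1 else 0 := by
  simp only [mono, wordForm_word, EmbeddingLike.apply_eq_iff_eq]

theorem basisFreeMonoid_repr (a : FreeAlgebra 𝕜 X) (w : FreeMonoid X) :
    (FreeAlgebra.basisFreeMonoid 𝕜 X).repr a w = wordForm 𝕜 X a (mono 𝕜 w.toList) := by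
  classical rw [← basisFreeMonoid_eq_mono, wordForm, Module.Basis.toDual_apply_left]

theorem wordForm_isSymm : (wordForm 𝕜 X).IsSymm := by
  classical exact isSymm_toDual _

/-- The space spanned by the words of a set `T`; the homogeneous components are the case of all
words of a given length. -/
def wordSpan (T : Set (List X)) : Submodule 𝕜 (FreeAlgebra 𝕜 X) :=
  Submodule.span 𝕜 (mono 𝕜 '' T)

theorem ass_eq_wordSpan (n : ℕ) : ass 𝕜 X n = wordSpan 𝕜 {l | l.length = n} :=
  rfl

theorem wordForm_mono_of_notMem {T : Set (List X)} {a : FreeAlgebra 𝕜 X} (ha : a ∈ wordSpan 𝕜 T)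
    {l : List X} (hl : l ∉ T) : wordForm 𝕜 X a (mono 𝕜 l) = 0 := by
  have : wordSpan 𝕜 T ≤ LinearMap.ker ((wordForm 𝕜 X).flip (mono 𝕜 l)) := by
    refine Submodule.span_le.2 ?_
    rintro _ ⟨m, hm, rfl⟩
    classical exact (wordForm_mono 𝕜 m l).trans (if_neg (ne_of_mem_of_not_mem hm hl))
  exact this ha

theorem wordForm_eq_zero_of_disjoint {T U : Set (List X)} (h : Disjoint T U)
    {a b : FreeAlgebra 𝕜 X} (ha : a ∈ wordSpan 𝕜 T) (hb : b ∈ wordSpan 𝕜 U) :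
    wordForm 𝕜 X a b = 0 := by
  have : wordSpan 𝕜 U ≤ LinearMap.ker (wordForm 𝕜 X a) := by
    refine Submodule.span_le.2 ?_
    rintro _ ⟨m, hm, rfl⟩
    exact wordForm_mono_of_notMem 𝕜 ha (h.notMem_of_mem_right hm)
  exact this hb

open Classical in
/-- The operator deleting the first letter of a word if it is `x`, and killing all other words. It
is adjoint to multiplication by `x` on the left, and a derivation for the shuffle product. -/
def leftDeriv (x : X) : FreeAlgebra 𝕜 X →ₗ[𝕜] FreeAlgebra 𝕜 X :=
  (FreeAlgebra.basisFreeMonoid 𝕜 X).constr 𝕜 fun w =>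
    match w.toList with
    | [] => 0
    | y :: l => if y = x then mono 𝕜 l else 0

theorem leftDeriv_one (x : X) : leftDeriv 𝕜 x 1 = 0 := by
  rw [← mono_nil, ← FreeMonoid.toList_one, ← basisFreeMonoid_eq_mono, leftDeriv,
    Module.Basis.constr_basis]
  rfl

theorem leftDeriv_ι_mul [DecidableEq X] (x y : X) (a : FreeAlgebra 𝕜 X) :
    leftDeriv 𝕜 x (FreeAlgebra.ι 𝕜 y * a) = if y = x then a else 0 := by
  have : leftDeriv 𝕜 x ∘ₗ LinearMap.mulLeft 𝕜 (FreeAlgebra.ι 𝕜 y) =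
      if y = x then LinearMap.id else 0 :=
    linearMap_ext_mono fun l => by
      rw [LinearMap.comp_apply, LinearMap.mulLeft_apply, ← mono_cons,
        ← FreeMonoid.toList_ofList (y :: l), ← basisFreeMonoid_eq_mono, leftDeriv,
        Module.Basis.constr_basis]
      split_ifs with h <;> simp [h]
  have := LinearMap.congr_fun this a
  split_ifs at this ⊢ <;> exact this

theorem wordForm_ι_mul_left (x : X) (a b : FreeAlgebra 𝕜 X) :
    wordForm 𝕜 X (FreeAlgebra.ι 𝕜 x * a) b = wordForm 𝕜 X a (leftDeriv 𝕜 x b) := by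
  classical
  have : wordForm 𝕜 X ∘ₗ LinearMap.mulLeft 𝕜 (FreeAlgebra.ι 𝕜 x) =
      (wordForm 𝕜 X).compl₂ (leftDeriv 𝕜 x) :=
    linearMap_ext_mono₂ fun l m => by
      rw [LinearMap.comp_apply, LinearMap.mulLeft_apply, LinearMap.compl₂_apply, ← mono_cons]
      rcases m with _ | ⟨y, m⟩
      · rw [wordForm_mono, mono_nil, leftDeriv_one, map_zero, if_neg (List.cons_ne_nil x l)]
      · rw [mono_cons 𝕜 y m, leftDeriv_ι_mul, ← mono_cons, wordForm_mono]
        split_ifs <;> simp_all [wordForm_mono]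
  exact LinearMap.congr_fun₂ this a b

/-! ### The shuffle product -/

theorem shuffle_mono (u v : List X) :
    shuffle 𝕜 X (mono 𝕜 u) (mono 𝕜 v) = ((shuffles u v).map (mono 𝕜)).sum :=
  shuffle_word 𝕜 _ _

theorem shuffles_nil_right (u : List X) : shuffles u [] = [u] := by
  cases u <;> simp only [shuffles]

theorem shuffle_one_left (a : FreeAlgebra 𝕜 X) : shuffle 𝕜 X 1 a = a := by
  have : shuffle 𝕜 X 1 = LinearMap.id := linearMap_ext_mono fun l => by
    simp [← mono_nil, shuffle_mono, shuffles]
  exact LinearMap.congr_fun this a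

theorem shuffle_one_right (a : FreeAlgebra 𝕜 X) : shuffle 𝕜 X a 1 = a := by
  have : (shuffle 𝕜 X).flip 1 = LinearMap.id := linearMap_ext_mono fun l => by
    simp [← mono_nil, shuffle_mono, shuffles_nil_right]
  exact LinearMap.congr_fun this a

theorem shuffle_ι_mul_ι_mul (x y : X) (a b : FreeAlgebra 𝕜 X) :
    shuffle 𝕜 X (FreeAlgebra.ι 𝕜 x * a) (FreeAlgebra.ι 𝕜 y * b) =
      FreeAlgebra.ι 𝕜 x * shuffle 𝕜 X a (FreeAlgebra.ι 𝕜 y * b) +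
        FreeAlgebra.ι 𝕜 y * shuffle 𝕜 X (FreeAlgebra.ι 𝕜 x * a) b := by
  have : (shuffle 𝕜 X).compl₁₂ (LinearMap.mulLeft 𝕜 (FreeAlgebra.ι 𝕜 x))
        (LinearMap.mulLeft 𝕜 (FreeAlgebra.ι 𝕜 y)) =
      ((shuffle 𝕜 X).compl₂ (LinearMap.mulLeft 𝕜 (FreeAlgebra.ι 𝕜 y))).compr₂
          (LinearMap.mulLeft 𝕜 (FreeAlgebra.ι 𝕜 x)) +
        (shuffle 𝕜 X ∘ₗ LinearMap.mulLeft 𝕜 (FreeAlgebra.ι 𝕜 x)).compr₂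
          (LinearMap.mulLeft 𝕜 (FreeAlgebra.ι 𝕜 y)) :=
    linearMap_ext_mono₂ fun u v => by
      simp [← mono_cons, shuffle_mono, shuffles, ← List.sum_map_mul_left, Function.comp_def]
  exact LinearMap.congr_fun₂ this a b

theorem leftDeriv_shuffle (x : X) (a b : FreeAlgebra 𝕜 X) :
    leftDeriv 𝕜 x (shuffle 𝕜 X a b) =
      shuffle 𝕜 X (leftDeriv 𝕜 x a) b + shuffle 𝕜 X a (leftDeriv 𝕜 x b) := by
  classical
  have : (shuffle 𝕜 X).compr₂ (leftDeriv 𝕜 x) =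
      shuffle 𝕜 X ∘ₗ leftDeriv 𝕜 x + (shuffle 𝕜 X).compl₂ (leftDeriv 𝕜 x) :=
    linearMap_ext_mono₂ fun u v => by
      simp only [LinearMap.compr₂_apply, LinearMap.add_apply, LinearMap.comp_apply,
        LinearMap.compl₂_apply]
      rcases u with _ | ⟨y, u⟩
      · simp [mono_nil, shuffle_one_left, leftDeriv_one]
      rcases v with _ | ⟨z, v⟩
      · simp [mono_nil, shuffle_one_right, leftDeriv_one]
      · simp only [mono_cons, shuffle_ι_mul_ι_mul, map_add, leftDeriv_ι_mul]
        split_ifs <;> simp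
  exact LinearMap.congr_fun₂ this a b

theorem wordForm_one_one : wordForm 𝕜 X 1 1 = 1 := by
  classical rw [← mono_nil, wordForm_mono, if_pos rfl]

theorem wordForm_one_shuffle (a b : FreeAlgebra 𝕜 X) :
    wordForm 𝕜 X 1 (shuffle 𝕜 X a b) = wordForm 𝕜 X 1 a * wordForm 𝕜 X 1 b := by
  have wordForm_one_ι_mul (x : X) (c : FreeAlgebra 𝕜 X) :
      wordForm 𝕜 X 1 (FreeAlgebra.ι 𝕜 x * c) = 0 := by
    rw [(wordForm_isSymm 𝕜).eq, wordForm_ι_mul_left, leftDeriv_one, map_zero]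
  have : (shuffle 𝕜 X).compr₂ (wordForm 𝕜 X 1) =
      (LinearMap.mul 𝕜 𝕜).compl₁₂ (wordForm 𝕜 X 1) (wordForm 𝕜 X 1) :=
    linearMap_ext_mono₂ fun u v => by
      rcases u with _ | ⟨y, u⟩
      · simp [mono_nil, shuffle_one_left, wordForm_one_one]
      rcases v with _ | ⟨z, v⟩
      · simp [mono_nil, shuffle_one_right, wordForm_one_one]
      · simp [mono_cons, shuffle_ι_mul_ι_mul, wordForm_one_ι_mul]
  exact LinearMap.congr_fun₂ this a b

/-! ### The coproduct -/

variable (X) in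
/-- The coproduct of the free associative algebra for which the letters are primitive. -/
def coproduct : FreeAlgebra 𝕜 X →ₐ[𝕜] FreeAlgebra 𝕜 X ⊗[𝕜] FreeAlgebra 𝕜 X :=
  FreeAlgebra.lift 𝕜 fun x => FreeAlgebra.ι 𝕜 x ⊗ₜ 1 + 1 ⊗ₜ FreeAlgebra.ι 𝕜 x

theorem coproduct_ι (x : X) :
    coproduct 𝕜 X (FreeAlgebra.ι 𝕜 x) = FreeAlgebra.ι 𝕜 x ⊗ₜ 1 + 1 ⊗ₜ FreeAlgebra.ι 𝕜 x :=
  FreeAlgebra.lift_ι_apply _ x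

theorem coproduct_of_mem_lieElements {a : FreeAlgebra 𝕜 X} (ha : a ∈ lieElements 𝕜 X) :
    coproduct 𝕜 X a = a ⊗ₜ 1 + 1 ⊗ₜ a := by
  induction ha using LieSubalgebra.lieSpan_induction with
  | mem a h =>
    obtain ⟨x, rfl⟩ := h
    exact coproduct_ι 𝕜 x
  | zero => simp only [map_zero, TensorProduct.zero_tmul, TensorProduct.tmul_zero, add_zero]
  | add a b _ _ ha hb =>
    simp only [map_add, ha, hb, TensorProduct.add_tmul, TensorProduct.tmul_add]
    abel
  | smul c a _ ha =>
    simp only [map_smul, ha, smul_add, TensorProduct.smul_tmul', TensorProduct.tmul_smul]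
  | lie a b _ _ ha hb =>
    simp only [LieRing.of_associative_ring_bracket, map_sub, map_mul, ha, hb, add_mul, mul_add,
      Algebra.TensorProduct.tmul_mul_tmul, one_mul, mul_one, TensorProduct.sub_tmul,
      TensorProduct.tmul_sub]
    abel

theorem tmul_wordForm_tmul_tmul (a b c d : FreeAlgebra 𝕜 X) :
    (wordForm 𝕜 X).tmul (wordForm 𝕜 X) (a ⊗ₜ b) (c ⊗ₜ d) =
      wordForm 𝕜 X a c * wordForm 𝕜 X b d := by
  rw [LinearMap.BilinForm.tensorDistrib_tmul, smul_eq_mul, mul_comm]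

theorem ext_tmul_wordForm {s t : FreeAlgebra 𝕜 X ⊗[𝕜] FreeAlgebra 𝕜 X}
    (h : ∀ u v, (wordForm 𝕜 X).tmul (wordForm 𝕜 X) s (mono 𝕜 u ⊗ₜ mono 𝕜 v) =
      (wordForm 𝕜 X).tmul (wordForm 𝕜 X) t (mono 𝕜 u ⊗ₜ mono 𝕜 v)) : s = t := by
  let B := FreeAlgebra.basisFreeMonoid 𝕜 X
  have repr_eq (t) (u v : FreeMonoid X) : (B.tensorProduct B).repr t (u, v) =
      (wordForm 𝕜 X).tmul (wordForm 𝕜 X) t (mono 𝕜 u.toList ⊗ₜ mono 𝕜 v.toList) := by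
    induction t using TensorProduct.induction_on with
    | zero => simp only [map_zero, Finsupp.zero_apply, LinearMap.zero_apply]
    | add s t hs ht => simp only [map_add, Finsupp.add_apply, LinearMap.add_apply, hs, ht]
    | tmul a b =>
      rw [Module.Basis.tensorProduct_repr_tmul_apply, tmul_wordForm_tmul_tmul,
        basisFreeMonoid_repr, basisFreeMonoid_repr, smul_eq_mul, mul_comm]
  refine (B.tensorProduct B).ext_elem fun w => ?_
  rw [repr_eq, repr_eq]
  exact h _ _

theorem tmul_wordForm_coproduct_ι_mul (x : X) (t : FreeAlgebra 𝕜 X ⊗[𝕜] FreeAlgebra 𝕜 X)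
    (b c : FreeAlgebra 𝕜 X) :
    (wordForm 𝕜 X).tmul (wordForm 𝕜 X) (coproduct 𝕜 X (FreeAlgebra.ι 𝕜 x) * t) (b ⊗ₜ c) =
      (wordForm 𝕜 X).tmul (wordForm 𝕜 X) t (leftDeriv 𝕜 x b ⊗ₜ c + b ⊗ₜ leftDeriv 𝕜 x c) := by
  induction t using TensorProduct.induction_on with
  | zero => simp only [mul_zero, map_zero, LinearMap.zero_apply]
  | add s t hs ht =>
    rw [mul_add, map_add, LinearMap.add_apply, hs, ht, ← LinearMap.add_apply, ← map_add]
  | tmul a d =>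
    simp only [coproduct_ι, add_mul, Algebra.TensorProduct.tmul_mul_tmul,
      one_mul, map_add, LinearMap.add_apply, tmul_wordForm_tmul_tmul, wordForm_ι_mul_left]

theorem tmul_wordForm_coproduct (a b c : FreeAlgebra 𝕜 X) :
    (wordForm 𝕜 X).tmul (wordForm 𝕜 X) (coproduct 𝕜 X a) (b ⊗ₜ c) =
      wordForm 𝕜 X a (shuffle 𝕜 X b c) := by
  have : LinearMap.flip ((wordForm 𝕜 X).tmul (wordForm 𝕜 X)) (b ⊗ₜ c) ∘ₗ
        (coproduct 𝕜 X).toLinearMap =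
      LinearMap.flip (wordForm 𝕜 X) (shuffle 𝕜 X b c) :=
    linearMap_ext_mono fun l => by
      induction l generalizing b c with
      | nil =>
        simp only [LinearMap.comp_apply, LinearMap.flip_apply, AlgHom.toLinearMap_apply, mono_nil,
          map_one, Algebra.TensorProduct.one_def, tmul_wordForm_tmul_tmul, wordForm_one_shuffle]
      | cons x l ih =>
        simp only [LinearMap.comp_apply, LinearMap.flip_apply, AlgHom.toLinearMap_apply] at ih ⊢
        rw [mono_cons, map_mul, tmul_wordForm_coproduct_ι_mul, map_add, ih, ih,
          ← map_add, ← leftDeriv_shuffle, wordForm_ι_mul_left]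
  exact LinearMap.congr_fun this a

theorem wordForm_shuffle_of_mem_lieElements {a : FreeAlgebra 𝕜 X} (ha : a ∈ lieElements 𝕜 X)
    (b c : FreeAlgebra 𝕜 X) :
    wordForm 𝕜 X a (shuffle 𝕜 X b c) =
      wordForm 𝕜 X a b * wordForm 𝕜 X 1 c + wordForm 𝕜 X 1 b * wordForm 𝕜 X a c := by
  rw [← tmul_wordForm_coproduct, coproduct_of_mem_lieElements 𝕜 ha, map_add, LinearMap.add_apply,
    tmul_wordForm_tmul_tmul, tmul_wordForm_tmul_tmul]

theorem wordForm_eq_zero_of_mem_lieElements_of_mem_shuffleComponent {n : ℕ}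
    {a c : FreeAlgebra 𝕜 X} (ha : a ∈ lieElements 𝕜 X) (hc : c ∈ shuffleComponent 𝕜 X n) :
    wordForm 𝕜 X a c = 0 := by
  have wordForm_one_eq_zero {p : ℕ} (hp : 0 < p) {b : FreeAlgebra 𝕜 X} (hb : b ∈ ass 𝕜 X p) :
      wordForm 𝕜 X 1 b = 0 := by
    rw [(wordForm_isSymm 𝕜).eq, ← mono_nil]
    exact wordForm_mono_of_notMem 𝕜 hb hp.ne
  have : shuffleComponent 𝕜 X n ≤ LinearMap.ker (wordForm 𝕜 X a) := by
    refine Submodule.span_le.2 ?_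
    rintro _ ⟨p, q, hp, hq, -, b, hb, c, hc, rfl⟩
    rw [SetLike.mem_coe, LinearMap.mem_ker, wordForm_shuffle_of_mem_lieElements 𝕜 ha,
      wordForm_one_eq_zero hp hb, wordForm_one_eq_zero hq hc, mul_zero, zero_mul, add_zero]
  exact this hc

/-! ### Friedrichs' and Ree's criteria -/

variable (X) in
/-- The antipode of the free associative algebra, which reverses words and changes the sign of those
of odd length. -/
def antipode : FreeAlgebra 𝕜 X →ₗ[𝕜] FreeAlgebra 𝕜 X :=
  (MulOpposite.opLinearEquiv 𝕜).symm.toLinearMap ∘ₗ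
    (FreeAlgebra.lift 𝕜 fun x => MulOpposite.op (-FreeAlgebra.ι 𝕜 x)).toLinearMap

theorem antipode_one : antipode 𝕜 X 1 = 1 := by
  simp [antipode]

theorem antipode_mul_ι (a : FreeAlgebra 𝕜 X) (x : X) :
    antipode 𝕜 X (a * FreeAlgebra.ι 𝕜 x) = -(FreeAlgebra.ι 𝕜 x * antipode 𝕜 X a) := by
  simp [antipode]

/-- The convolution `S ⋆ f` of the antipode `S` with a linear map `f`, sending `a` with coproduct
`∑ a' ⊗ a''` to `∑ S(a') f(a'')`. -/
def antipodeConv (f : FreeAlgebra 𝕜 X →ₗ[𝕜] FreeAlgebra 𝕜 X) :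
    FreeAlgebra 𝕜 X →ₗ[𝕜] FreeAlgebra 𝕜 X :=
  LinearMap.mul' 𝕜 _ ∘ₗ TensorProduct.map (antipode 𝕜 X) f ∘ₗ (coproduct 𝕜 X).toLinearMap

theorem antipodeConv_add (f g : FreeAlgebra 𝕜 X →ₗ[𝕜] FreeAlgebra 𝕜 X) :
    antipodeConv 𝕜 (f + g) = antipodeConv 𝕜 f + antipodeConv 𝕜 g := by
  simp only [antipodeConv, TensorProduct.map_add_right, LinearMap.add_comp, LinearMap.comp_add]

theorem antipodeConv_mulRight_comp (f : FreeAlgebra 𝕜 X →ₗ[𝕜] FreeAlgebra 𝕜 X)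
    (a b : FreeAlgebra 𝕜 X) :
    antipodeConv 𝕜 (LinearMap.mulRight 𝕜 b ∘ₗ f) a = antipodeConv 𝕜 f a * b := by
  simp only [antipodeConv, LinearMap.comp_apply]
  induction (coproduct 𝕜 X).toLinearMap a using TensorProduct.induction_on with
  | zero => simp only [map_zero, zero_mul]
  | add s t hs ht => simp only [map_add, hs, ht, add_mul]
  | tmul u v =>
    simp only [TensorProduct.map_tmul, LinearMap.mul'_apply, LinearMap.comp_apply,
      LinearMap.mulRight_apply, mul_assoc]

theorem antipodeConv_mul_ι (f : FreeAlgebra 𝕜 X →ₗ[𝕜] FreeAlgebra 𝕜 X) (a : FreeAlgebra 𝕜 X)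
    (x : X) :
    antipodeConv 𝕜 f (a * FreeAlgebra.ι 𝕜 x) =
      antipodeConv 𝕜 (f ∘ₗ LinearMap.mulRight 𝕜 (FreeAlgebra.ι 𝕜 x)) a -
        FreeAlgebra.ι 𝕜 x * antipodeConv 𝕜 f a := by
  simp only [antipodeConv, LinearMap.comp_apply, AlgHom.toLinearMap_apply, map_mul]
  induction coproduct 𝕜 X a using TensorProduct.induction_on with
  | zero => simp only [zero_mul, map_zero, mul_zero, sub_zero]
  | add s t hs ht =>
    simp only [add_mul, map_add, hs, ht, mul_add]
    abel
  | tmul u v =>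
    simp only [coproduct_ι, mul_add, Algebra.TensorProduct.tmul_mul_tmul,
      mul_one, map_add, TensorProduct.map_tmul, LinearMap.mul'_apply, antipode_mul_ι,
      LinearMap.comp_apply, LinearMap.mulRight_apply]
    noncomm_ring

theorem antipodeConv_id (a : FreeAlgebra 𝕜 X) :
    antipodeConv 𝕜 LinearMap.id a = algebraMap 𝕜 _ (FreeAlgebra.algebraMapInv a) := by
  have : antipodeConv 𝕜 LinearMap.id =
      Algebra.linearMap 𝕜 (FreeAlgebra 𝕜 X) ∘ₗ FreeAlgebra.algebraMapInv.toLinearMap :=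
    linearMap_ext_mono fun l => by
      induction l using List.reverseRecOn with
      | nil =>
        simp [mono_nil, antipodeConv, Algebra.TensorProduct.one_def, antipode_one]
      | append_singleton l x ih =>
        rw [mono_append, mono_cons, mono_nil, mul_one, antipodeConv_mul_ι, LinearMap.id_comp,
          ← LinearMap.comp_id (LinearMap.mulRight _ _), antipodeConv_mulRight_comp, ih]
        simp [FreeAlgebra.algebraMapInv, Algebra.commutes]
  exact LinearMap.congr_fun this a

variable (X) in
/-- The Euler operator, which multiplies every word by its length. -/
def euler : FreeAlgebra 𝕜 X →ₗ[𝕜] FreeAlgebra 𝕜 X :=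
  (FreeAlgebra.basisFreeMonoid 𝕜 X).constr 𝕜 fun w => (w.length : 𝕜) • mono 𝕜 w.toList

theorem euler_mono (l : List X) : euler 𝕜 X (mono 𝕜 l) = (l.length : 𝕜) • mono 𝕜 l := by
  rw [← FreeMonoid.toList_ofList l, ← basisFreeMonoid_eq_mono, euler, Module.Basis.constr_basis,
    basisFreeMonoid_eq_mono]
  rfl

theorem euler_one : euler 𝕜 X 1 = 0 := by
  rw [← mono_nil, euler_mono, List.length_nil, Nat.cast_zero, zero_smul]

theorem euler_of_mem_ass {n : ℕ} {a : FreeAlgebra 𝕜 X} (ha : a ∈ ass 𝕜 X n) :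
    euler 𝕜 X a = (n : 𝕜) • a := by
  refine LinearMap.eqOn_span (g := (n : 𝕜) • LinearMap.id) ?_ ha
  rintro _ ⟨w, rfl, rfl⟩
  exact euler_mono 𝕜 w.toList

theorem euler_comp_mulRight_ι (x : X) :
    euler 𝕜 X ∘ₗ LinearMap.mulRight 𝕜 (FreeAlgebra.ι 𝕜 x) =
      LinearMap.mulRight 𝕜 (FreeAlgebra.ι 𝕜 x) ∘ₗ (euler 𝕜 X + LinearMap.id) :=
  linearMap_ext_mono fun l => by
    have mono_mul_ι : mono 𝕜 l * FreeAlgebra.ι 𝕜 x = mono 𝕜 (l ++ [x]) := by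
      rw [mono_append, mono_cons, mono_nil, mul_one]
    simp [mono_mul_ι, euler_mono, add_mul, add_smul]

variable (X) in
/-- The Dynkin operator, defined as the convolution of the antipode with the Euler operator. It maps
a word `x₁x₂⋯xᵣ` to the left-normed bracket `[⋯[[x₁, x₂], x₃], ⋯, xᵣ]`. -/
def dynkin : FreeAlgebra 𝕜 X →ₗ[𝕜] FreeAlgebra 𝕜 X :=
  antipodeConv 𝕜 (euler 𝕜 X)

theorem dynkin_mul_ι (a : FreeAlgebra 𝕜 X) (x : X) :
    dynkin 𝕜 X (a * FreeAlgebra.ι 𝕜 x) =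
      ⁅dynkin 𝕜 X a, FreeAlgebra.ι 𝕜 x⁆ + FreeAlgebra.algebraMapInv a • FreeAlgebra.ι 𝕜 x := by
  rw [dynkin, antipodeConv_mul_ι, euler_comp_mulRight_ι, antipodeConv_mulRight_comp,
    antipodeConv_add, LinearMap.add_apply, antipodeConv_id, add_mul, ← Algebra.smul_def,
    LieRing.of_associative_ring_bracket, sub_add_eq_add_sub]

theorem dynkin_one : dynkin 𝕜 X 1 = 0 := by
  simp [dynkin, antipodeConv, Algebra.TensorProduct.one_def, euler_one]

theorem dynkin_mem_lieElements (a : FreeAlgebra 𝕜 X) : dynkin 𝕜 X a ∈ lieElements 𝕜 X := by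
  have ι_mem (x : X) : FreeAlgebra.ι 𝕜 x ∈ lieElements 𝕜 X :=
    LieSubalgebra.subset_lieSpan ⟨x, rfl⟩
  have : (lieElements 𝕜 X).toSubmodule.mkQ ∘ₗ dynkin 𝕜 X = 0 :=
    linearMap_ext_mono fun l => (Submodule.Quotient.mk_eq_zero _).2 <| by
      induction l using List.reverseRecOn with
      | nil => simp only [mono_nil, dynkin_one, zero_mem]
      | append_singleton l x ih =>
        rw [mono_append, mono_cons, mono_nil, mul_one, dynkin_mul_ι]
        exact add_mem ((lieElements 𝕜 X).lie_mem ih (ι_mem x)) (Submodule.smul_mem _ _ (ι_mem x))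
  exact (Submodule.Quotient.mk_eq_zero _).1 (LinearMap.congr_fun this a)

theorem dynkin_eq_euler_of_coproduct_eq {a : FreeAlgebra 𝕜 X}
    (h : coproduct 𝕜 X a = a ⊗ₜ 1 + 1 ⊗ₜ a) : dynkin 𝕜 X a = euler 𝕜 X a := by
  simp [dynkin, antipodeConv, h, antipode_one, euler_one]

theorem mem_lieElements_of_coproduct_eq {n : ℕ} (hn : (n : 𝕜) ≠ 0) {a : FreeAlgebra 𝕜 X}
    (ha : a ∈ ass 𝕜 X n) (h : coproduct 𝕜 X a = a ⊗ₜ 1 + 1 ⊗ₜ a) : a ∈ lieElements 𝕜 X := by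
  have hdyn : dynkin 𝕜 X a = (n : 𝕜) • a := by
    rw [dynkin_eq_euler_of_coproduct_eq 𝕜 h, euler_of_mem_ass 𝕜 ha]
  rw [← inv_smul_smul₀ hn a, ← hdyn]
  exact (lieElements 𝕜 X).smul_mem _ (dynkin_mem_lieElements 𝕜 a)

theorem mem_lieElements_of_orthogonal_shuffles {n : ℕ} (hn : (n : 𝕜) ≠ 0) {a : FreeAlgebra 𝕜 X}
    (ha : a ∈ ass 𝕜 X n) (h : ∀ u v : List X, u ≠ [] → v ≠ [] →
      wordForm 𝕜 X a (shuffle 𝕜 X (mono 𝕜 u) (mono 𝕜 v)) = 0) : a ∈ lieElements 𝕜 X := by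
  classical
  refine mem_lieElements_of_coproduct_eq 𝕜 hn ha (ext_tmul_wordForm 𝕜 fun u v => ?_)
  have ha_nil : wordForm 𝕜 X a (mono 𝕜 []) = 0 :=
    wordForm_mono_of_notMem 𝕜 ha fun h => hn (by rw [← show 0 = n from h, Nat.cast_zero])
  rw [tmul_wordForm_coproduct, map_add, LinearMap.add_apply, tmul_wordForm_tmul_tmul,
    tmul_wordForm_tmul_tmul, ← mono_nil, wordForm_mono, wordForm_mono]
  rcases eq_or_ne u [] with rfl | hu
  · rw [mono_nil, shuffle_one_left, ← mono_nil, ha_nil, if_pos rfl, zero_mul, one_mul, zero_add]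
  rcases eq_or_ne v [] with rfl | hv
  · rw [mono_nil, shuffle_one_right, ← mono_nil, ha_nil, if_pos rfl, mul_zero, mul_one, add_zero]
  · rw [h u v hu hv, if_neg hu.symm, if_neg hv.symm, mul_zero, zero_mul, add_zero]

/-! ### Spans of shuffle products -/

theorem perm_append_of_mem_shuffles {u v w : List X} (h : w ∈ shuffles u v) : w.Perm (u ++ v) := by
  induction u, v using shuffles.induct generalizing w with
  | case1 v => simp_all [shuffles]
  | case2 a u => simp_all [shuffles]
  | case3 a u b v ih₁ ih₂ =>
    simp only [shuffles, List.mem_append, List.mem_map] at h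
    rcases h with ⟨w, hw, rfl⟩ | ⟨w, hw, rfl⟩
    · exact (ih₁ hw).cons a
    · exact ((ih₂ hw).cons b).trans List.perm_middle.symm

theorem shuffle_mono_mem_wordSpan (u v : List X) :
    shuffle 𝕜 X (mono 𝕜 u) (mono 𝕜 v) ∈ wordSpan 𝕜 {l | l.Perm (u ++ v)} := by
  rw [shuffle_mono]
  refine list_sum_mem fun a ha => ?_
  obtain ⟨w, hw, rfl⟩ := List.mem_map.1 ha
  exact Submodule.subset_span ⟨w, perm_append_of_mem_shuffles hw, rfl⟩

/-- The span of the shuffle products of two nonempty words whose concatenation belongs to `T`. For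
the words of a given length it is `shuffleComponent`; for the rearrangements of a single word it is
finite-dimensional, even if there are infinitely many letters. -/
def shuffleSpan (T : Set (List X)) : Submodule 𝕜 (FreeAlgebra 𝕜 X) :=
  Submodule.span 𝕜 {c | ∃ u v, u ≠ [] ∧ v ≠ [] ∧ u ++ v ∈ T ∧
    shuffle 𝕜 X (mono 𝕜 u) (mono 𝕜 v) = c}

theorem shuffleSpan_mono {T U : Set (List X)} (h : T ⊆ U) : shuffleSpan 𝕜 T ≤ shuffleSpan 𝕜 U :=
  Submodule.span_mono fun _ ⟨u, v, hu, hv, huv, hc⟩ => ⟨u, v, hu, hv, h huv, hc⟩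

theorem shuffleSpan_le_wordSpan {T : Set (List X)} (hT : ∀ l ∈ T, ∀ m, m.Perm l → m ∈ T) :
    shuffleSpan 𝕜 T ≤ wordSpan 𝕜 T := by
  refine Submodule.span_le.2 ?_
  rintro _ ⟨u, v, -, -, huv, rfl⟩
  exact Submodule.span_mono (Set.image_mono fun l hl => hT _ huv l hl)
    (shuffle_mono_mem_wordSpan 𝕜 u v)

theorem shuffleComponent_eq_shuffleSpan (n : ℕ) :
    shuffleComponent 𝕜 X n = shuffleSpan 𝕜 {l | l.length = n} := by
  refine le_antisymm (Submodule.span_le.2 ?_) (Submodule.span_mono ?_)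
  · rintro _ ⟨p, q, hp, hq, rfl, a, ha, b, hb, rfl⟩
    have hle : Submodule.map₂ (shuffle 𝕜 X) (ass 𝕜 X p) (ass 𝕜 X q) ≤
        shuffleSpan 𝕜 {l | l.length = p + q} := by
      rw [ass, ass, Submodule.map₂_span_span]
      refine Submodule.span_mono ?_
      rintro _ ⟨_, ⟨u, rfl, rfl⟩, _, ⟨v, rfl, rfl⟩, rfl⟩
      exact ⟨u.toList, v.toList, List.ne_nil_of_length_pos hp, List.ne_nil_of_length_pos hq,
        List.length_append, rfl⟩
    exact hle (Submodule.apply_mem_map₂ _ ha hb)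
  · rintro _ ⟨u, v, hu, hv, rfl, rfl⟩
    exact ⟨u.length, v.length, List.length_pos_of_ne_nil hu, List.length_pos_of_ne_nil hv,
      List.length_append.symm, _, Submodule.subset_span ⟨_, rfl, rfl⟩, _,
      Submodule.subset_span ⟨_, rfl, rfl⟩, rfl⟩

theorem shuffleComponent_le_ass (n : ℕ) : shuffleComponent 𝕜 X n ≤ ass 𝕜 X n := by
  rw [shuffleComponent_eq_shuffleSpan, ass_eq_wordSpan]
  exact shuffleSpan_le_wordSpan 𝕜 fun l hl m hm => hm.length_eq.trans hl

theorem disjoint_shuffleSpan_orthogonal [CharZero 𝕜] (T : Set (List X)) :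
    Disjoint (shuffleSpan 𝕜 T) ((wordForm 𝕜 X).orthogonal (shuffleSpan 𝕜 T)) := by
  classical
  refine disjoint_span_orthogonal_of_repr_mem_range (FreeAlgebra.basisFreeMonoid 𝕜 X) ?_
  rintro _ ⟨u, v, -, -, -, rfl⟩ w
  rw [basisFreeMonoid_repr, (wordForm_isSymm 𝕜).eq, shuffle_mono, map_list_sum]
  refine list_sum_mem fun c hc => ?_
  simp only [List.map_map, List.mem_map, Function.comp_apply, wordForm_mono] at hc
  obtain ⟨l, -, rfl⟩ := hc
  split_ifs
  exacts [one_mem _, zero_mem _]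

theorem isCompl_shuffleSpan_orthogonal [CharZero 𝕜] (w : List X) :
    IsCompl (shuffleSpan 𝕜 {l | l.Perm w})
      ((wordForm 𝕜 X).orthogonal (shuffleSpan 𝕜 {l | l.Perm w})) := by
  have hfin : {l : List X | l.Perm w}.Finite := by
    simpa only [List.mem_permutations] using w.permutations.finite_toSet
  have : FiniteDimensional 𝕜 (wordSpan 𝕜 {l | l.Perm w}) :=
    FiniteDimensional.span_of_finite 𝕜 (hfin.image (mono 𝕜))
  have := Submodule.finiteDimensional_of_le
    (shuffleSpan_le_wordSpan 𝕜 (T := {l | l.Perm w}) fun l hl m hm => hm.trans hl)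
  exact isCompl_orthogonal_of_disjoint (wordForm_isSymm 𝕜).isRefl
    (disjoint_shuffleSpan_orthogonal 𝕜 _)

theorem mono_mem_lieComponent_sup_shuffleComponent [CharZero 𝕜] {w : List X} (hw : w ≠ []) :
    mono 𝕜 w ∈ lieComponent 𝕜 X w.length ⊔ shuffleComponent 𝕜 X w.length := by
  let T : Set (List X) := {l | l.Perm w}
  have perm_mem : ∀ l ∈ T, ∀ m, m.Perm l → m ∈ T := fun l hl m hm => hm.trans hl
  have T_subset : T ⊆ {l | l.length = w.length} := fun l hl => hl.length_eq
  have mono_mem : mono 𝕜 w ∈ wordSpan 𝕜 T := Submodule.subset_span ⟨w, List.Perm.refl w, rfl⟩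
  obtain ⟨s, hs, c, hc, hsc⟩ := Submodule.mem_sup.1
    ((isCompl_shuffleSpan_orthogonal 𝕜 w).sup_eq_top ▸ Submodule.mem_top : mono 𝕜 w ∈ _)
  have hcT : c ∈ wordSpan 𝕜 T := by
    rw [← add_sub_cancel_left s c, hsc]
    exact sub_mem mono_mem (shuffleSpan_le_wordSpan 𝕜 perm_mem hs)
  have hc_ass : c ∈ ass 𝕜 X w.length := Submodule.span_mono (Set.image_mono T_subset) hcT
  have hc_orth (u v : List X) (hu : u ≠ []) (hv : v ≠ []) :
      wordForm 𝕜 X c (shuffle 𝕜 X (mono 𝕜 u) (mono 𝕜 v)) = 0 := by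
    by_cases huv : u ++ v ∈ T
    · rw [(wordForm_isSymm 𝕜).eq]
      exact hc _ (Submodule.subset_span ⟨u, v, hu, hv, huv, rfl⟩)
    · refine wordForm_eq_zero_of_disjoint 𝕜 (Set.disjoint_left.2 fun l hl hl' => ?_) hcT
        (shuffle_mono_mem_wordSpan 𝕜 u v)
      exact huv ((List.Perm.symm hl').trans hl)
  have hc_lie : c ∈ lieElements 𝕜 X := mem_lieElements_of_orthogonal_shuffles 𝕜
    (Nat.cast_ne_zero.2 (List.length_pos_of_ne_nil hw).ne') hc_ass hc_orth
  rw [← hsc, sup_comm, shuffleComponent_eq_shuffleSpan]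
  exact Submodule.add_mem_sup (shuffleSpan_mono 𝕜 T_subset hs) ⟨hc_lie, hc_ass⟩

theorem disjoint_lieComponent_shuffleComponent [CharZero 𝕜] (n : ℕ) :
    Disjoint (lieComponent 𝕜 X n) (shuffleComponent 𝕜 X n) := by
  have hdisj := disjoint_shuffleSpan_orthogonal 𝕜 (X := X) {l | l.length = n}
  rw [← shuffleComponent_eq_shuffleSpan] at hdisj
  refine (hdisj.mono_right fun a ha c hc => ?_).symm
  rw [(wordForm_isSymm 𝕜).eq]
  exact wordForm_eq_zero_of_mem_lieElements_of_mem_shuffleComponent 𝕜 ha.1 hc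

theorem lieComponent_sup_shuffleComponent [CharZero 𝕜] {n : ℕ} (hn : n ≠ 0) :
    lieComponent 𝕜 X n ⊔ shuffleComponent 𝕜 X n = ass 𝕜 X n := by
  refine le_antisymm (sup_le inf_le_right (shuffleComponent_le_ass 𝕜 n)) (Submodule.span_le.2 ?_)
  rintro _ ⟨w, rfl, rfl⟩
  exact mono_mem_lieComponent_sup_shuffleComponent 𝕜 fun h => hn (congrArg List.length h)

end

end FreeAss

theorem theorem2_general (𝕜 : Type*) [Field 𝕜] [CharZero 𝕜] (X : Type*) (k : ℕ) (hk : 1 ≤ k) :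
    (∀ a ∈ FreeAss.lieComponent 𝕜 X k, ∀ b ∈ FreeAss.shuffleComponent 𝕜 X k,
      FreeAss.wordForm 𝕜 X a b = 0) ∧
    Disjoint (FreeAss.lieComponent 𝕜 X k) (FreeAss.shuffleComponent 𝕜 X k) ∧
    FreeAss.lieComponent 𝕜 X k ⊔ FreeAss.shuffleComponent 𝕜 X k = FreeAss.ass 𝕜 X k :=
  ⟨fun _ ha _ hb =>
    FreeAss.wordForm_eq_zero_of_mem_lieElements_of_mem_shuffleComponent 𝕜 ha.1 hb,
    FreeAss.disjoint_lieComponent_shuffleComponent 𝕜 k,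
    FreeAss.lieComponent_sup_shuffleComponent 𝕜 (Nat.one_le_iff_ne_zero.1 hk)⟩

theorem theorem2 (𝕜 : Type*) [Field 𝕜] [CharZero 𝕜] (X : Type*) [Finite X] (k : ℕ) (hk : 1 ≤ k) :
    (∀ a ∈ FreeAss.lieComponent 𝕜 X k, ∀ b ∈ FreeAss.shuffleComponent 𝕜 X k,
      FreeAss.wordForm 𝕜 X a b = 0) ∧
    Disjoint (FreeAss.lieComponent 𝕜 X k) (FreeAss.shuffleComponent 𝕜 X k) ∧
    FreeAss.lieComponent 𝕜 X k ⊔ FreeAss.shuffleComponent 𝕜 X k = FreeAss.ass 𝕜 X k :=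
  theorem2_general 𝕜 X k hk
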